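/- Let $C_{-1}(0,+\infty)$ be the set of functions $f:(0,+\infty)\to\mathbb R$ of the form $f(t)=t^{p}f_1(t)$ with $p>-1$ and $f_1\in C[0,+\infty)$, and let $(f*g)(t)=\int_0^t f(t-\tau)g(\tau)\,d\tau$. Let $\kappa,k_1,k_2\in C_{-1}(0,+\infty)$ satisfy $(\kappa*k_1*k_2)(t)=1$ for all $t>0$, and let $n\in\mathbb N$, $n\ge 1$. Put $\mathbb I_{(k)}f=k*f$, $\mathbb D_{(k)}f=\frac{d}{dt}\mathbb I_{(k)}f$, ${}_{1L}\mathbb D_{(k_1,k_2)}f=\mathbb I_{(k_1)}\frac{d}{dt}\mathbb I_{(k_2)}f$, and let ${}_{1L}\mathbb D^{<j>}_{(k_1,k_2)}$ be the $j$-fold composition of ${}_{1L}\mathbb D_{(k_1,k_2)}$ (the identity for $j=0$). Let $C^{m}_{-1,(k_1,k_2)}(0,+\infty)$ be the set of $f$ such that, for $j=0,\dots,m$, ${}_{1L}\mathbb D^{<j>}_{(k_1,k_2)}f$ and $\mathbb D_{(k_2)}\,{}_{1L}\mathbb D^{<j>}_{(k_1,k_2)}f$ exist on $(0,+\infty)$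 and belong to $C_{-1}(0,+\infty)$. $\mathcal R_{-1}=(C_{-1}(0,+\infty),+,*)$ is a commutative ring without zero divisors and without unity. Let $\mathcal F_{-1}$ be its field of convolution quotients $f/g$ ($g\ne0$), in which $f_1/g_1=f_2/g_2$ if and only if $f_1*g_2=f_2*g_1$. It contains $\mathcal R_{-1}$ via $f\mapsto (f*\kappa)/\kappa$ and is a real vector space via $\lambda\,(f/g)=(\lambda f)/g$. Let $S_\kappa=\kappa/(\kappa*\kappa)\in\mathcal F_{-1}$, let $S_\kappa^0$ be the unity of $\mathcal F_{-1}$, and let $\kappa^{<j>}$ be the $j$-fold convolution power of $\kappa$. For a function $g$ on $(0,+\infty)$ let $g(0)=\lim_{t\to0+}g(t)$. The $n$-fold sequential 1st level algebraic general fractional derivative of $f$ is the element $$A_n f:=S_\kappa^n\cdot f-S_\kappa^n\cdot P^{<n>}f,\qquad P^{<n>}f=\sum_{j=0}^{n-1}\bigl(\mathbb I_{(k_2)}\,{}_{1L}\mathbb D^{<j>}_{(k_1,k_2)}f\bigr)(0)\;\kappa^{<j+1>}*k_1,$$ of $\mathcal F_{-1}$. **Theorem.** Let $f\in C^{n-1}_{-1,(k_1,k_2)}(0,+\infty)$.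 Then ${}_{1L}\mathbb D^{<n>}_{(k_1,k_2)}f$ exists in the usual sense (in each of the $n$ steps, the integrals converge and the derivative exists at every $t>0$) and belongs to $C_{-1}(0,+\infty)$, the limits $\bigl(\mathbb I_{(k_2)}\,{}_{1L}\mathbb D^{<j>}_{(k_1,k_2)}f\bigr)(0)$, $0\le j\le n-1$, exist and are finite, and in $\mathcal F_{-1}$, where functions from $\mathcal R_{-1}$ are interpreted as elements of $\mathcal F_{-1}$, $${}_{1L}\mathbb D^{<n>}_{(k_1,k_2)}f=A_nf=S_\kappa^n\cdot f-\sum_{j=0}^{n-1}\bigl(\mathbb I_{(k_2)}\,{}_{1L}\mathbb D^{<j>}_{(k_1,k_2)}f\bigr)(0)\,S_\kappa^{n-j-1}\cdot k_1 .$$ -/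

import Mathlib

open Set Filter Topology MeasureTheory

set_option linter.unusedSimpArgs false

noncomputable section

namespace GFC

/-- The Laplace convolution `(f * g)(t) = ∫₀ᵗ f(t - τ) g(τ) dτ`. -/
def conv (f g : ℝ → ℝ) (t : ℝ) : ℝ := ∫ τ in (0 : ℝ)..t, f (t - τ) * g τ

/-- The space `C_{-1}(0,+∞)`. Only the values at `t > 0` matter. -/
def MemC (f : ℝ → ℝ) : Prop :=
  ∃ p : ℝ, -1 < p ∧ ∃ f₁ : ℝ → ℝ, ContinuousOn f₁ (Ici 0) ∧ ∀ t, 0 < t → f t = t ^ p * f₁ t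

/-- The extension by zero of the restriction of `f` to `(0,+∞)`. -/
def zext (f : ℝ → ℝ) : ℝ → ℝ := indicator (Ioi 0) f

theorem zext_of_pos (f : ℝ → ℝ) {t : ℝ} (ht : 0 < t) : zext f t = f t := indicator_of_mem ht f

theorem zext_of_nonpos (f : ℝ → ℝ) {t : ℝ} (ht : t ≤ 0) : zext f t = 0 :=
  indicator_of_notMem (by simpa using ht) f

theorem MemC.exists_continuous {f : ℝ → ℝ} (hf : MemC f) : ∃ p : ℝ, -1 < p ∧ ∃ f₁ : ℝ → ℝ,
    Continuous f₁ ∧ ∀ t, 0 < t → f t = t ^ p * f₁ t := by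
  obtain ⟨p, hp, f₁, hc, h⟩ := hf
  refine ⟨p, hp, fun t => f₁ (max t 0), hc.comp_continuous (by fun_prop) (fun x => by simp), ?_⟩
  intro t ht
  simp only [max_eq_left ht.le, h t ht]

theorem MemC.congr {f g : ℝ → ℝ} (hf : MemC f) (h : ∀ t, 0 < t → g t = f t) : MemC g := by
  obtain ⟨p, hp, f₁, hc, h'⟩ := hf
  exact ⟨p, hp, f₁, hc, fun t ht => by rw [h t ht, h' t ht]⟩

theorem MemC.zext {f : ℝ → ℝ} (hf : MemC f) : MemC (zext f) :=
  hf.congr fun _ ht => zext_of_pos f ht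

theorem MemC.zero : MemC (fun _ => 0) := ⟨0, by norm_num, fun _ => 0, continuousOn_const, by simp⟩

theorem MemC.one : MemC (fun _ => 1) := ⟨0, by norm_num, fun _ => 1, continuousOn_const, by simp⟩

theorem MemC.smul {f : ℝ → ℝ} (hf : MemC f) (c : ℝ) : MemC (fun t => c * f t) := by
  obtain ⟨p, hp, f₁, hc, h⟩ := hf
  exact ⟨p, hp, fun t => c * f₁ t, continuousOn_const.mul hc, fun t ht => by simp only [h t ht]; ring⟩

theorem MemC.add {f g : ℝ → ℝ} (hf : MemC f) (hg : MemC g) : MemC (fun t => f t + g t) := by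
  have key : ∀ {f g : ℝ → ℝ} {p q : ℝ} {f₁ g₁ : ℝ → ℝ}, -1 < p → p ≤ q → ContinuousOn f₁ (Ici 0) →
      ContinuousOn g₁ (Ici 0) → (∀ t, 0 < t → f t = t ^ p * f₁ t) →
      (∀ t, 0 < t → g t = t ^ q * g₁ t) → MemC (fun t => f t + g t) := by
    intro f g p q f₁ g₁ hp hpq hf hg h h'
    refine ⟨p, hp, fun t => f₁ t + t ^ (q - p) * g₁ t,
      hf.add (ContinuousOn.mul ?_ hg), fun t ht => ?_⟩
    · exact (Real.continuous_rpow_const (by linarith)).continuousOn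
    · simp only [h t ht, h' t ht]
      rw [mul_add, ← mul_assoc, ← Real.rpow_add ht]
      ring_nf
  obtain ⟨p, hp, f₁, hc, h⟩ := hf
  obtain ⟨q, hq, g₁, hc', h'⟩ := hg
  rcases le_total p q with hpq | hpq
  · exact key hp hpq hc hc' h h'
  · exact (key hq hpq hc' hc h' h).congr fun t _ => add_comm _ _

theorem MemC.sum {ι : Type*} (s : Finset ι) {f : ι → ℝ → ℝ} (hf : ∀ i, MemC (f i)) :
    MemC (fun t => ∑ i ∈ s, f i t) := by
  classical
  induction s using Finset.induction_on with
  | empty => simpa using MemC.zero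
  | insert a s ha ih => simpa [Finset.sum_insert ha] using (hf a).add ih

theorem MemC.abs {f : ℝ → ℝ} (hf : MemC f) : MemC (fun t => |f t|) := by
  obtain ⟨p, hp, f₁, hc, h⟩ := hf
  refine ⟨p, hp, fun t => |f₁ t|, hc.abs, fun t ht => ?_⟩
  simp only [h t ht]
  rw [abs_mul, abs_of_nonneg (Real.rpow_nonneg ht.le p)]

theorem MemC.continuousOn {f : ℝ → ℝ} (hf : MemC f) : ContinuousOn f (Ioi 0) := by
  obtain ⟨p, hp, f₁, hc, h⟩ := hf.exists_continuous
  refine ContinuousOn.congr (f := fun t => t ^ p * f₁ t) ?_ (fun t ht => h t ht)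
  exact (continuousOn_id.rpow_const fun x hx => Or.inl (ne_of_gt hx)).mul hc.continuousOn

theorem MemC.intervalIntegrable {f : ℝ → ℝ} (hf : MemC f) {a : ℝ} (ha : 0 ≤ a) :
    IntervalIntegrable f volume 0 a := by
  obtain ⟨p, hp, f₁, hc, h⟩ := hf.exists_continuous
  have := (intervalIntegral.intervalIntegrable_rpow' (a := 0) (b := a) hp).mul_continuousOn
    hc.continuousOn
  refine this.congr ?_
  intro t ht
  rw [uIoc_of_le ha] at ht
  exact (h t ht.1).symm

theorem MemC.conv_half {f g : ℝ → ℝ} (hf : MemC f) (hg : MemC g) {t : ℝ} (ht : 0 < t) :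
    IntervalIntegrable (fun τ => f (t - τ) * g τ) volume 0 (t / 2) := by
  refine (hg.intervalIntegrable (by positivity)).continuousOn_mul ?_
  refine hf.continuousOn.comp (by fun_prop) fun τ hτ => ?_
  rw [uIcc_of_le (by positivity)] at hτ
  have := hτ.2
  simp only [mem_Ioi]; linarith

theorem MemC.conv_intervalIntegrable {f g : ℝ → ℝ} (hf : MemC f) (hg : MemC g) {t : ℝ}
    (ht : 0 < t) : IntervalIntegrable (fun τ => f (t - τ) * g τ) volume 0 t := by
  refine (hf.conv_half hg ht).trans ?_
  have := (hg.conv_half hf ht).comp_sub_left t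
  have h2 : t - t / 2 = t / 2 := by ring
  simp only [sub_zero, sub_sub_cancel, h2] at this
  simpa only [mul_comm] using this.symm

theorem MemC.conv {f g : ℝ → ℝ} (hf : MemC f) (hg : MemC g) : MemC (conv f g) := by
  obtain ⟨p, hp, f₁, hc, h⟩ := hf.exists_continuous
  obtain ⟨q, hq, g₁, hc', h'⟩ := hg.exists_continuous
  refine ⟨p + q + 1, by linarith, fun t => ∫ s in (0 : ℝ)..1,
    ((1 - s) ^ p * s ^ q) * (f₁ (t * (1 - s)) * g₁ (t * s)), ?_, ?_⟩
  · have hw : IntervalIntegrable (fun s : ℝ => (1 - s) ^ p * s ^ q) volume 0 1 := by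
      have h1 : MemC (fun s : ℝ => s ^ p) := ⟨p, hp, fun _ => 1, continuousOn_const, by simp⟩
      have h2 : MemC (fun s : ℝ => s ^ q) := ⟨q, hq, fun _ => 1, continuousOn_const, by simp⟩
      exact h1.conv_intervalIntegrable h2 one_pos
    refine Continuous.continuousOn (continuous_iff_continuousAt.2 fun t₀ => ?_)
    obtain ⟨M, hM⟩ := ((isCompact_closedBall t₀ 1).prod (isCompact_Icc (a := (0 : ℝ)) (b := 1))
      ).exists_bound_of_continuousOn (f := fun x : ℝ × ℝ => f₁ (x.1 * (1 - x.2)) * g₁ (x.1 * x.2))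
      (by fun_prop)
    refine intervalIntegral.continuousAt_of_dominated_interval
      (bound := fun s => ‖(1 - s) ^ p * s ^ q‖ * M) ?_ ?_ (hw.norm.mul_const M) ?_
    · refine Eventually.of_forall fun t => ?_
      refine AEStronglyMeasurable.mul ?_ ?_
      · rw [uIoc_of_le zero_le_one]; exact hw.1.aestronglyMeasurable
      · exact (by fun_prop : Continuous fun s => f₁ (t * (1 - s)) * g₁ (t * s)).aestronglyMeasurable
    · filter_upwards [Metric.closedBall_mem_nhds t₀ one_pos] with t ht
      refine Eventually.of_forall fun s hs => ?_
      rw [uIoc_of_le zero_le_one] at hs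
      rw [norm_mul]
      exact mul_le_mul_of_nonneg_left (hM (t, s) ⟨ht, ⟨hs.1.le, hs.2⟩⟩) (norm_nonneg _)
    · exact Eventually.of_forall fun s _ => (by fun_prop : Continuous fun t =>
        ((1 - s) ^ p * s ^ q) * (f₁ (t * (1 - s)) * g₁ (t * s))).continuousAt
  · intro t ht
    have := intervalIntegral.mul_integral_comp_mul_left (a := 0) (b := 1)
      (f := fun τ => f (t - τ) * g τ) (c := t)
    simp only [mul_zero, mul_one] at this
    rw [GFC.conv, ← this, ← intervalIntegral.integral_const_mul,
      ← intervalIntegral.integral_const_mul]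
    refine intervalIntegral.integral_congr_ae ?_
    have h1 : ∀ᵐ s : ℝ, s ≠ 1 := by simp [ae_iff]
    filter_upwards [h1] with s hs1 hs
    rw [uIoc_of_le zero_le_one] at hs
    have hs0 := hs.1
    have hs1' : 0 < 1 - s := sub_pos.2 (lt_of_le_of_ne hs.2 hs1)
    have e : t - t * s = t * (1 - s) := by ring
    rw [e, h _ (mul_pos ht hs1'), h' _ (mul_pos ht hs0), Real.mul_rpow ht.le hs1'.le,
      Real.mul_rpow ht.le hs0.le, Real.rpow_add ht, Real.rpow_add ht, Real.rpow_one]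
    ring

theorem conv_comm (f g : ℝ → ℝ) (t : ℝ) : conv f g t = conv g f t := by
  have := intervalIntegral.integral_comp_sub_left (a := 0) (b := t)
    (fun τ => g (t - τ) * f τ) t
  simp only [sub_zero, sub_self, sub_sub_cancel] at this
  rw [conv, conv, ← this]
  simp only [mul_comm]

theorem conv_congr {f f' g g' : ℝ → ℝ} (hf : ∀ t, 0 < t → f t = f' t)
    (hg : ∀ t, 0 < t → g t = g' t) {t : ℝ} (ht : 0 < t) : conv f g t = conv f' g' t := by
  refine intervalIntegral.integral_congr_ae ?_
  have h1 : ∀ᵐ s : ℝ, s ≠ t := by simp [ae_iff]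
  filter_upwards [h1] with s hs1 hs
  rw [uIoc_of_le ht.le] at hs
  rw [hf _ (sub_pos.2 (lt_of_le_of_ne hs.2 hs1)), hg _ hs.1]

theorem conv_add {f g h : ℝ → ℝ} (hf : MemC f) (hg : MemC g) (hh : MemC h) {t : ℝ} (ht : 0 < t) :
    conv f (fun s => g s + h s) t = conv f g t + conv f h t := by
  rw [conv, conv, conv, ← intervalIntegral.integral_add (hf.conv_intervalIntegrable hg ht)
    (hf.conv_intervalIntegrable hh ht)]
  simp only [mul_add]

theorem conv_smul (f g : ℝ → ℝ) (c t : ℝ) :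
    conv f (fun s => c * g s) t = c * conv f g t := by
  rw [conv, conv, ← intervalIntegral.integral_const_mul]
  refine intervalIntegral.integral_congr fun s _ => ?_
  ring

open ContinuousLinearMap in
theorem zext_conv (f g : ℝ → ℝ) (t : ℝ) :
    zext (conv f g) t = convolution (zext f) (zext g) (mul ℝ ℝ) volume t := by
  have := congrFun (posConvolution_eq_convolution_indicator f g (mul ℝ ℝ) volume) t
  refine Eq.trans ?_ this
  rw [posConvolution]
  by_cases ht : 0 < t
  · rw [zext_of_pos _ ht, indicator_of_mem (mem_Ioi.2 ht), conv_comm]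
    simp [conv, mul_comm]
  · rw [zext_of_nonpos _ (not_lt.1 ht), indicator_of_notMem (by simpa using ht)]

open ContinuousLinearMap in
theorem MemC.convolutionExistsAt {f g : ℝ → ℝ} (hf : MemC f) (hg : MemC g) (t : ℝ) :
    ConvolutionExistsAt (GFC.zext f) (GFC.zext g) t (mul ℝ ℝ) volume := by
  rw [ConvolutionExistsAt]
  by_cases ht : 0 < t
  · have h1 := (hg.conv_intervalIntegrable hf ht).1
    have h2 := (integrable_indicator_iff measurableSet_Ioo).2 (h1.mono_set Ioo_subset_Ioc_self)
    refine h2.congr (Eventually.of_forall fun s => ?_)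
    simp only [mul_apply']
    by_cases hs : s ∈ Ioo 0 t
    · rw [indicator_of_mem hs, zext_of_pos _ hs.1, zext_of_pos _ (sub_pos.2 hs.2), mul_comm]
    · rw [indicator_of_notMem hs]
      by_cases h0 : 0 < s
      · rw [zext_of_nonpos g (sub_nonpos.2 (not_lt.1 fun h => hs ⟨h0, h⟩)), mul_zero]
      · rw [zext_of_nonpos f (not_lt.1 h0), zero_mul]
  · refine (integrable_zero ℝ ℝ volume).congr (Eventually.of_forall fun s => ?_)
    simp only [mul_apply']
    by_cases h0 : 0 < s
    · rw [zext_of_nonpos g (by linarith), mul_zero]; rfl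
    · rw [zext_of_nonpos f (not_lt.1 h0), zero_mul]; rfl

theorem MemC.aestronglyMeasurable {f : ℝ → ℝ} (hf : MemC f) :
    AEStronglyMeasurable (GFC.zext f) volume :=
  (aestronglyMeasurable_indicator_iff measurableSet_Ioi).2
    (hf.continuousOn.aestronglyMeasurable measurableSet_Ioi)

theorem norm_zext (f : ℝ → ℝ) : (fun t => ‖zext f t‖) = zext (fun t => |f t|) := by
  ext t
  by_cases h : 0 < t
  · simp [zext_of_pos _ h]
  · simp [zext_of_nonpos _ (not_lt.1 h)]

open ContinuousLinearMap in
theorem conv_assoc {f g h : ℝ → ℝ} (hf : MemC f) (hg : MemC g) (hh : MemC h) {t : ℝ} (ht : 0 < t) :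
    conv (conv f g) h t = conv f (conv g h) t := by
  have e : ∀ f g : ℝ → ℝ, zext (conv f g) = convolution (zext f) (zext g) (mul ℝ ℝ) volume :=
    fun f g => funext (zext_conv f g)
  rw [← zext_of_pos (conv (conv f g) h) ht, ← zext_of_pos (conv f (conv g h)) ht, e, e, e, e]
  refine convolution_assoc (mul ℝ ℝ) (mul ℝ ℝ) (mul ℝ ℝ) (mul ℝ ℝ) (fun x y z => by simp [mul_assoc])
    hf.aestronglyMeasurable hg.aestronglyMeasurable hh.aestronglyMeasurable
    (Eventually.of_forall fun y => hf.convolutionExistsAt hg y) ?_ ?_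
  · refine Eventually.of_forall fun y => ?_
    rw [norm_zext, norm_zext]
    exact hg.abs.convolutionExistsAt hh.abs y
  · rw [norm_zext, norm_zext, norm_zext, ← e]
    exact hf.abs.convolutionExistsAt (hg.abs.conv hh.abs) t


/-! Convolution has no zero divisors on `(0,+∞)`. -/

theorem hasSum_exp_integral {φ w : ℝ → ℝ} (hφ : Continuous φ) (hw : Continuous w) (c T : ℝ) :
    HasSum (fun k : ℕ => c ^ k / k.factorial * ∫ u in (0 : ℝ)..T, w u ^ k * φ u)
      (∫ u in (0 : ℝ)..T, Real.exp (c * w u) * φ u) := by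
  have hs : ∀ x : ℝ, HasSum (fun k : ℕ => x ^ k / k.factorial) (Real.exp x) := fun x => by
    rw [Real.exp_eq_exp_ℝ]; exact NormedSpace.expSeries_div_hasSum_exp x
  have h := intervalIntegral.hasSum_integral_of_dominated_convergence (μ := volume) (a := 0) (b := T)
    (F := fun (k : ℕ) u => c ^ k / k.factorial * (w u ^ k * φ u))
    (f := fun u => Real.exp (c * w u) * φ u)
    (fun k u => |c * w u| ^ k / k.factorial * |φ u|) ?_ ?_ ?_ ?_ ?_
  · simpa only [intervalIntegral.integral_const_mul] using h
  · intro k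
    exact (by fun_prop : Continuous _).aestronglyMeasurable
  · intro k
    refine Eventually.of_forall fun u _ => le_of_eq ?_
    simp only [norm_mul, norm_div, norm_pow, Real.norm_eq_abs, abs_mul, mul_pow, Nat.abs_cast]
    ring
  · exact Eventually.of_forall fun u _ => ((hs |c * w u|).mul_right _).summable
  · refine Continuous.intervalIntegrable ?_ _ _
    have : (fun u => ∑' k : ℕ, |c * w u| ^ k / (k.factorial : ℝ) * |φ u|)
        = fun u => Real.exp |c * w u| * |φ u| :=
      funext fun u => ((hs |c * w u|).mul_right _).tsum_eq
    rw [this]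
    fun_prop
  · refine Eventually.of_forall fun u _ => ?_
    have e : ∀ k : ℕ, (c * w u) ^ k / k.factorial * φ u
        = c ^ k / k.factorial * (w u ^ k * φ u) := fun k => by rw [mul_pow]; ring
    simpa only [e] using (hs (c * w u)).mul_right (φ u)

theorem eq_zero_of_primitive_const {φ : ℝ → ℝ} (hφ : ContinuousOn φ (Ioi 0)) {T c : ℝ}
    (hi : ∀ t, 0 < t → IntervalIntegrable φ volume 0 t)
    (h : ∀ t, 0 < t → t < T → ∫ u in (0 : ℝ)..t, φ u = c) {t : ℝ} (ht : 0 < t) (htT : t < T) :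
    φ t = 0 := by
  have h1 : HasDerivAt (fun x => ∫ u in (0 : ℝ)..x, φ u) (φ t) t :=
    intervalIntegral.integral_hasDerivAt_right (hi t ht)
      (hφ.stronglyMeasurableAtFilter isOpen_Ioi t ht)
      (hφ.continuousAt (Ioi_mem_nhds ht))
  have h2 : HasDerivAt (fun x => ∫ u in (0 : ℝ)..x, φ u) 0 t := by
    refine (hasDerivAt_const t c).congr_of_eventuallyEq ?_
    filter_upwards [Ioo_mem_nhds ht htT] with x hx using h x hx.1 hx.2
  exact h1.unique h2

theorem eq_zero_of_exp_moments_bounded {φ : ℝ → ℝ} (hφ : Continuous φ) {T M : ℝ}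
    (hM : ∀ n : ℕ, |∫ u in (0 : ℝ)..T, Real.exp (n * u) * φ u| ≤ M) {t : ℝ} (ht : 0 < t)
    (htT : t < T) : φ t = 0 := by
  refine eq_zero_of_primitive_const hφ.continuousOn (fun t _ => hφ.intervalIntegrable _ _)
    (c := ∫ u in (0 : ℝ)..T, φ u) ?_ ht htT
  clear ht htT t
  intro t ht htT
  have hT : 0 < T := ht.trans htT
  have hs : ∀ n : ℕ, HasSum (fun k : ℕ => (-Real.exp (-(n * t))) ^ k / k.factorial *
      ∫ u in (0 : ℝ)..T, Real.exp (n * u) ^ k * φ u)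
      (∫ u in (0 : ℝ)..T, Real.exp (-Real.exp (-(n * t)) * Real.exp (n * u)) * φ u) := fun n =>
    hasSum_exp_integral hφ (by fun_prop) _ T
  have hpow : ∀ (n k : ℕ) (u : ℝ), Real.exp (n * u) ^ k = Real.exp ((k * n : ℕ) * u) := by
    intro n k u
    rw [← Real.exp_nat_mul]; push_cast; ring_nf
  have lim1 : Tendsto (fun n : ℕ => ∑' k : ℕ, (-Real.exp (-(n * t))) ^ k / k.factorial *
      ∫ u in (0 : ℝ)..T, Real.exp (n * u) ^ k * φ u) atTop
      (𝓝 (∑' k : ℕ, if k = 0 then ∫ u in (0 : ℝ)..T, φ u else 0)) := by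
    have hx : Tendsto (fun n : ℕ => Real.exp (-(n * t))) atTop (𝓝 0) :=
      Real.tendsto_exp_neg_atTop_nhds_zero.comp
        (tendsto_natCast_atTop_atTop.atTop_mul_const ht)
    have hb : ∀ n k : ℕ, ‖(-Real.exp (-(n * t))) ^ k / k.factorial *
      ∫ u in (0 : ℝ)..T, Real.exp (n * u) ^ k * φ u‖ ≤
        Real.exp (-(n * t)) ^ k * (1 / k.factorial * M) := by
      intro n k
      simp only [hpow]
      rw [norm_mul, norm_div, norm_pow, norm_neg, Real.norm_eq_abs, Real.norm_eq_abs,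
        Real.norm_eq_abs, abs_of_pos (Real.exp_pos _), Nat.abs_cast, div_eq_mul_one_div, mul_assoc]
      gcongr
      exact hM _
    have hM0 : 0 ≤ M := (abs_nonneg _).trans (hM 0)
    refine tendsto_tsum_of_dominated_convergence (bound := fun k : ℕ => 1 / k.factorial * M)
      ?_ ?_ ?_
    · have := (Real.summable_pow_div_factorial 1).mul_right M
      simpa using this
    · intro k
      rcases Nat.eq_zero_or_pos k with rfl | hk
      · simp
      · rw [if_neg hk.ne']
        refine squeeze_zero_norm (hb · k) ?_
        have := (hx.pow k).mul_const (1 / (k.factorial : ℝ) * M)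
        simpa [hk.ne'] using this
    · refine Eventually.of_forall fun n k => (hb n k).trans ?_
      refine mul_le_of_le_one_left (by positivity) (pow_le_one₀ (Real.exp_pos _).le ?_)
      exact Real.exp_le_one_iff.2 (by have : 0 ≤ (n : ℝ) * t := by positivity
                                      linarith)
  have lim2 : Tendsto (fun n : ℕ =>
      ∫ u in (0 : ℝ)..T, Real.exp (-Real.exp (-(n * t)) * Real.exp (n * u)) * φ u) atTop
      (𝓝 (∫ u in (0 : ℝ)..T, indicator (Iic t) φ u)) := by
    refine intervalIntegral.tendsto_integral_filter_of_dominated_convergence (fun u => |φ u|)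
      (Eventually.of_forall fun n => (by fun_prop : Continuous _).aestronglyMeasurable) ?_
      (hφ.abs.intervalIntegrable _ _) ?_
    · refine Eventually.of_forall fun n => Eventually.of_forall fun u _ => ?_
      rw [norm_mul, Real.norm_eq_abs, Real.norm_eq_abs, abs_of_pos (Real.exp_pos _)]
      refine mul_le_of_le_one_left (abs_nonneg _) (Real.exp_le_one_iff.2 ?_)
      have := mul_pos (Real.exp_pos (-((n : ℝ) * t))) (Real.exp_pos ((n : ℝ) * u))
      linarith
    · have h1 : ∀ᵐ u : ℝ, u ≠ t := by simp [ae_iff]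
      filter_upwards [h1] with u hu _
      have e : ∀ n : ℕ, -Real.exp (-(n * t)) * Real.exp (n * u) = -Real.exp (n * (u - t)) := by
        intro n
        rw [neg_mul, ← Real.exp_add]; ring_nf
      simp only [e]
      rcases lt_or_gt_of_ne hu with hut | hut
      · rw [indicator_of_mem (mem_Iic.2 hut.le)]
        have : Tendsto (fun n : ℕ => Real.exp (n * (u - t))) atTop (𝓝 0) := by
          refine Real.tendsto_exp_atBot.comp ?_
          exact tendsto_natCast_atTop_atTop.atTop_mul_const_of_neg (by linarith)
        have := ((Real.continuous_exp.tendsto _).comp this.neg).mul_const (φ u)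
        simpa using this
      · rw [indicator_of_notMem (by simpa using hut)]
        have : Tendsto (fun n : ℕ => Real.exp (n * (u - t))) atTop atTop := by
          refine Real.tendsto_exp_atTop.comp ?_
          exact tendsto_natCast_atTop_atTop.atTop_mul_const (by linarith)
        have := (Real.tendsto_exp_neg_atTop_nhds_zero.comp this).mul_const (φ u)
        simpa using this
  have e1 : ∫ u in (0 : ℝ)..T, indicator (Iic t) φ u = ∫ u in (0 : ℝ)..t, φ u := by
    rw [intervalIntegral.integral_of_le hT.le, intervalIntegral.integral_of_le ht.le,
      integral_indicator measurableSet_Iic, Measure.restrict_restrict measurableSet_Iic]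
    have : Iic t ∩ Ioc 0 T = Ioc 0 t := by
      ext u
      simp only [mem_inter_iff, mem_Iic, mem_Ioc]
      constructor
      · exact fun h => ⟨h.2.1, h.1⟩
      · exact fun h => ⟨h.2, h.1, h.2.trans htT.le⟩
    rw [this]
  have e2 : (∑' k : ℕ, if k = 0 then ∫ u in (0 : ℝ)..T, φ u else 0) = ∫ u in (0 : ℝ)..T, φ u :=
    tsum_ite_eq 0 _
  rw [← e1]
  rw [e2] at lim1
  refine tendsto_nhds_unique lim2 (lim1.congr fun n => (hs n).tsum_eq)

open ContinuousLinearMap in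
theorem eq_zero_of_conv_self {F : ℝ → ℝ} (hF : Continuous F) (h : ∀ t, 0 < t → conv F F t = 0)
    {t : ℝ} (ht : 0 < t) : F t = 0 := by
  obtain ⟨T, hT⟩ : ∃ T, t < T := ⟨t + 1, by linarith⟩
  have hT0 : 0 < T := ht.trans hT
  have hin : ∀ n : ℕ, Integrable (indicator (Ioo 0 (2 * T)) (fun s => Real.exp (-(n * s)) * F s)) := by
    intro n
    refine (integrable_indicator_iff measurableSet_Ioo).2 ?_
    exact ((by fun_prop : Continuous fun s => Real.exp (-(n * s)) * F s).continuousOn.integrableOn_Icc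
      (a := 0) (b := 2 * T)).mono_set Ioo_subset_Icc_self
  set f : ℝ → ℝ := indicator (Ioo 0 (2 * T)) F with hf
  have hfi : Integrable f := by simpa using hin 0
  set K : ℝ → ℝ := convolution f f (mul ℝ ℝ) volume with hK
  have hKi : Integrable K := hfi.integrable_convolution (mul ℝ ℝ) hfi
  have hK0 : ∀ s, s < 2 * T → K s = 0 := by
    intro s hs
    have e : K s = convolution (zext F) (zext F) (mul ℝ ℝ) volume s := by
      simp only [hK, convolution, mul_apply']
      congr 1; ext u
      by_cases hu : 0 < u
      · by_cases hus : u < s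
        · rw [zext_of_pos _ hu, zext_of_pos _ (sub_pos.2 hus), hf,
            indicator_of_mem (by constructor <;> linarith),
            indicator_of_mem (by constructor <;> linarith)]
        · rw [zext_of_nonpos F (by linarith : s - u ≤ 0), hf, indicator_of_notMem (a := s - u)
            (fun h => hus (by linarith [h.1]))]
          simp
      · rw [zext_of_nonpos F (not_lt.1 hu), hf, indicator_of_notMem (a := u)
            (fun h => hu h.1)]
        simp
    rw [e, ← zext_conv]
    by_cases hs0 : 0 < s
    · rw [zext_of_pos _ hs0, h s hs0]
    · rw [zext_of_nonpos _ (not_lt.1 hs0)]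
  have hsq : ∀ n : ℕ, (∫ s in (0 : ℝ)..2 * T, Real.exp (-(n * s)) * F s) ^ 2
      ≤ Real.exp (-(n * (2 * T))) * ∫ s, |K s| := by
    intro n
    have e1 : (∫ s in (0 : ℝ)..2 * T, Real.exp (-(n * s)) * F s)
        = ∫ s, indicator (Ioo 0 (2 * T)) (fun s => Real.exp (-(n * s)) * F s) s := by
      rw [integral_indicator measurableSet_Ioo, intervalIntegral.integral_of_le (by positivity),
        integral_Ioc_eq_integral_Ioo]
    have e2 := integral_convolution (mul ℝ ℝ) (hin n) (hin n)
    have e3 : ∀ s, convolution (indicator (Ioo 0 (2 * T)) (fun s => Real.exp (-(n * s)) * F s))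
        (indicator (Ioo 0 (2 * T)) (fun s => Real.exp (-(n * s)) * F s)) (mul ℝ ℝ) volume s
        = Real.exp (-(n * s)) * K s := by
      intro s
      simp only [hK, convolution, mul_apply']
      rw [← integral_const_mul]
      congr 1; ext u
      have e4 : ∀ v, indicator (Ioo 0 (2 * T)) (fun s => Real.exp (-(n * s)) * F s) v
          = Real.exp (-(n * v)) * f v := by
        intro v
        by_cases hv : v ∈ Ioo 0 (2 * T)
        · rw [hf, indicator_of_mem hv, indicator_of_mem hv]
        · rw [hf, indicator_of_notMem hv, indicator_of_notMem hv, mul_zero]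
      have e5 : Real.exp (-(n * s)) = Real.exp (-(n * u)) * Real.exp (-(n * (s - u))) := by
        rw [← Real.exp_add]; ring_nf
      rw [e4, e4, e5]; ring
    simp only [e3, mul_apply'] at e2
    rw [e1, sq, ← e2, ← integral_const_mul]
    refine (le_abs_self _).trans ((abs_integral_le_integral_abs).trans ?_)
    refine integral_mono_of_nonneg (Eventually.of_forall fun s => abs_nonneg _)
      (hKi.abs.const_mul _) (Eventually.of_forall fun s => ?_)
    simp only [abs_mul, abs_of_pos (Real.exp_pos _)]
    by_cases hs : s < 2 * T
    · simp [hK0 s hs]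
    · refine mul_le_mul_of_nonneg_right (Real.exp_le_exp.2 ?_) (abs_nonneg _)
      have : (n : ℝ) * (2 * T) ≤ n * s := mul_le_mul_of_nonneg_left (not_lt.1 hs) (Nat.cast_nonneg n)
      linarith
  have hc : ∀ n : ℕ, Continuous fun s => Real.exp (n * (T - s)) * F s := fun n => by fun_prop
  have hJ : ∀ n : ℕ, |∫ s in (0 : ℝ)..2 * T, Real.exp (n * (T - s)) * F s|
      ≤ Real.sqrt (∫ s, |K s|) := by
    intro n
    refine Real.abs_le_sqrt ?_
    have e1 : ∫ s in (0 : ℝ)..2 * T, Real.exp (n * (T - s)) * F s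
        = Real.exp (n * T) * ∫ s in (0 : ℝ)..2 * T, Real.exp (-(n * s)) * F s := by
      rw [← intervalIntegral.integral_const_mul]
      refine intervalIntegral.integral_congr fun s _ => ?_
      simp only [← mul_assoc, ← Real.exp_add]
      ring_nf
    have e2 : Real.exp (n * T) ^ 2 * Real.exp (-(n * (2 * T))) = 1 := by
      rw [← Real.exp_nat_mul, ← Real.exp_add, Real.exp_eq_one_iff]; push_cast; ring
    rw [e1, mul_pow]
    calc _ ≤ Real.exp (n * T) ^ 2 * (Real.exp (-(n * (2 * T))) * ∫ s, |K s|) :=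
          mul_le_mul_of_nonneg_left (hsq n) (by positivity)
      _ = ∫ s, |K s| := by rw [← mul_assoc, e2, one_mul]
  have hM : ∀ n : ℕ, |∫ u in (0 : ℝ)..T, Real.exp (n * u) * F (T - u)|
      ≤ Real.sqrt (∫ s, |K s|) + ∫ s in T..2 * T, |F s| := by
    intro n
    have e1 := intervalIntegral.integral_comp_sub_left (a := 0) (b := T)
      (fun s => Real.exp (n * (T - s)) * F s) T
    simp only [sub_sub_cancel, sub_zero, sub_self] at e1
    have e2 := intervalIntegral.integral_add_adjacent_intervals
      ((hc n).intervalIntegrable (μ := volume) 0 T) ((hc n).intervalIntegrable T (2 * T))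
    have e3 : |∫ s in T..2 * T, Real.exp (n * (T - s)) * F s| ≤ ∫ s in T..2 * T, |F s| := by
      refine (intervalIntegral.abs_integral_le_integral_abs (by linarith)).trans ?_
      refine intervalIntegral.integral_mono_on (by linarith) ((hc n).abs.intervalIntegrable _ _)
        (hF.abs.intervalIntegrable _ _) fun s hs => ?_
      rw [abs_mul, abs_of_pos (Real.exp_pos _)]
      refine mul_le_of_le_one_left (abs_nonneg _) (Real.exp_le_one_iff.2 ?_)
      exact mul_nonpos_of_nonneg_of_nonpos (Nat.cast_nonneg n) (by linarith [hs.1])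
    rw [e1, eq_sub_of_add_eq e2]
    exact (abs_sub _ _).trans (add_le_add (hJ n) e3)
  have := eq_zero_of_exp_moments_bounded (φ := fun u => F (T - u)) (by fun_prop) hM
    (t := T - t) (by linarith) (by linarith)
  simpa using this

theorem eq_zero_of_conv_one {f : ℝ → ℝ} (hf : MemC f) (h : ∀ t, 0 < t → conv (fun _ => 1) f t = 0)
    {t : ℝ} (ht : 0 < t) : f t = 0 := by
  refine eq_zero_of_primitive_const hf.continuousOn (fun t ht => hf.intervalIntegrable ht.le)
    (c := 0) (T := t + 1) (fun s hs _ => ?_) ht (by linarith)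
  simpa [conv] using h s hs

/-- The antiderivative of an element of `C_{-1}(0,+∞)` extends to a continuous function. -/
theorem MemC.exists_primitive {f : ℝ → ℝ} (hf : MemC f) : ∃ F : ℝ → ℝ, Continuous F ∧
    ∀ t, 0 < t → F t = GFC.conv (fun _ => 1) f t := by
  refine ⟨fun t => ∫ u in (0 : ℝ)..t, GFC.zext f u, ?_, fun t ht => ?_⟩
  · refine intervalIntegral.continuous_primitive (fun a b => ?_) 0
    have key : ∀ a, IntervalIntegrable (GFC.zext f) volume 0 a := by
      intro a
      rcases le_total 0 a with ha | ha
      · exact hf.zext.intervalIntegrable ha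
      · refine IntervalIntegrable.congr (f := fun _ => (0 : ℝ)) ?_ (by simp)
        intro u hu
        rw [uIoc_of_ge ha] at hu
        exact (GFC.zext_of_nonpos f hu.2).symm
    exact (key a).symm.trans (key b)
  · simp only [GFC.conv, one_mul]
    refine intervalIntegral.integral_congr_ae (Eventually.of_forall fun u hu => ?_)
    rw [uIoc_of_le ht.le] at hu
    exact GFC.zext_of_pos f hu.1

theorem eq_zero_of_moments {φ : ℝ → ℝ} (hφ : Continuous φ) {T : ℝ}
    (hM : ∀ n : ℕ, ∫ u in (0 : ℝ)..T, u ^ n * φ u = 0) {t : ℝ} (ht : 0 < t) (htT : t < T) :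
    φ t = 0 := by
  refine eq_zero_of_exp_moments_bounded hφ (M := 0) (fun n => ?_) ht htT
  have := (hasSum_exp_integral hφ continuous_id (n : ℝ) T)
  simp only [id, hM, mul_zero] at this
  rw [this.unique hasSum_zero, abs_zero]


theorem zext_add (f g : ℝ → ℝ) : zext (fun t => f t + g t) = zext f + zext g := by
  ext t
  by_cases h : 0 < t
  · simp [zext_of_pos _ h]
  · simp [zext_of_nonpos _ (not_lt.1 h)]

/-! ### The convolution ring `R_{-1}` -/

/-- The vector space `C_{-1}(0,+∞)`; a function on `(0,+∞)` is represented by its extension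
by zero to `ℝ`. -/
def cSubmodule : Submodule ℝ (ℝ → ℝ) where
  carrier := {f | MemC f ∧ ∀ t ≤ 0, f t = 0}
  add_mem' := fun hf hg => ⟨hf.1.add hg.1, fun t ht => by simp [hf.2 t ht, hg.2 t ht]⟩
  zero_mem' := ⟨MemC.zero, fun _ _ => rfl⟩
  smul_mem' := fun c _ hf => ⟨hf.1.smul c, fun t ht => by simp [hf.2 t ht]⟩

/-- The underlying set of the ring `R_{-1} = (C_{-1}(0,+∞), +, *)`. -/
def CRing : Type := cSubmodule

namespace CRing

instance : AddCommGroup CRing := inferInstanceAs (AddCommGroup cSubmodule)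

instance : Module ℝ CRing := inferInstanceAs (Module ℝ cSubmodule)

instance : CoeFun CRing (fun _ => ℝ → ℝ) := ⟨fun f => f.1⟩

theorem memC (f : CRing) : MemC f := f.2.1

theorem ext {f g : CRing} (h : ∀ t, 0 < t → f t = g t) : f = g := by
  refine Subtype.ext (funext fun t => ?_)
  by_cases ht : 0 < t
  · exact h t ht
  · rw [f.2.2 t (not_lt.1 ht), g.2.2 t (not_lt.1 ht)]

/-- A function of the class `C_{-1}(0,+∞)` as an element of `R_{-1}`. -/
def of (f : ℝ → ℝ) (hf : MemC f) : CRing := ⟨zext f, hf.zext, fun _ ht => zext_of_nonpos f ht⟩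

theorem of_apply {f : ℝ → ℝ} (hf : MemC f) {t : ℝ} (ht : 0 < t) : of f hf t = f t :=
  zext_of_pos f ht

theorem add_apply (f g : CRing) (t : ℝ) : (f + g) t = f t + g t := rfl

theorem smul_apply (c : ℝ) (f : CRing) (t : ℝ) : (c • f) t = c * f t := rfl

theorem zero_apply (t : ℝ) : (0 : CRing) t = 0 := rfl

/-- The multiplication of `R_{-1}` is the Laplace convolution. -/
instance : Mul CRing := ⟨fun f g => of (conv f g) (f.memC.conv g.memC)⟩

theorem mul_apply (f g : CRing) {t : ℝ} (ht : 0 < t) : (f * g) t = conv f g t :=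
  zext_of_pos _ ht

theorem conv_mul_left (f g : CRing) (h : ℝ → ℝ) {t : ℝ} (ht : 0 < t) :
    conv (f * g : CRing) h t = conv (conv f g) h t :=
  conv_congr (fun _ hs => mul_apply f g hs) (fun _ _ => rfl) ht

theorem conv_mul_right (f : ℝ → ℝ) (g h : CRing) {t : ℝ} (ht : 0 < t) :
    conv f (g * h : CRing) t = conv f (conv g h) t :=
  conv_congr (fun _ _ => rfl) (fun _ hs => mul_apply g h hs) ht

protected theorem mul_comm' (f g : CRing) : f * g = g * f :=
  ext fun t ht => by rw [mul_apply f g ht, mul_apply g f ht, conv_comm]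

protected theorem mul_add' (f g h : CRing) : f * (g + h) = f * g + f * h :=
  ext fun t ht => by
    rw [add_apply, mul_apply _ _ ht, mul_apply _ _ ht, mul_apply _ _ ht]
    exact conv_add f.memC g.memC h.memC ht

protected theorem mul_smul' (c : ℝ) (f g : CRing) : f * (c • g) = c • (f * g) :=
  ext fun t ht => by
    rw [smul_apply, mul_apply _ _ ht, mul_apply _ _ ht]
    exact conv_smul f g c t

instance : NonUnitalCommRing CRing where
  mul_comm := CRing.mul_comm'
  mul_assoc f g h := ext fun t ht => by
    rw [mul_apply _ _ ht, mul_apply _ _ ht, conv_mul_left _ _ _ ht, conv_mul_right _ _ _ ht,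
      conv_assoc f.memC g.memC h.memC ht]
  left_distrib := CRing.mul_add'
  right_distrib f g h := by
    rw [CRing.mul_comm', CRing.mul_add', CRing.mul_comm' h f, CRing.mul_comm' h g]
  zero_mul f := by simpa [CRing.mul_comm'] using CRing.mul_smul' 0 f 0
  mul_zero f := by simpa using CRing.mul_smul' 0 f 0

theorem smul_mul (c : ℝ) (f g : CRing) : (c • f) * g = c • (f * g) := by
  rw [mul_comm, CRing.mul_smul', mul_comm]

/-- The constant function `1`. -/
def unit : CRing := of (fun _ => 1) MemC.one

theorem unit_mul_apply (f : CRing) {t : ℝ} (ht : 0 < t) :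
    (unit * f) t = conv (fun _ => 1) f t := by
  rw [mul_apply _ _ ht]
  exact conv_congr (fun _ hs => of_apply MemC.one hs) (fun _ _ => rfl) ht

theorem eq_zero_of_unit_mul {f : CRing} (h : unit * f = 0) : f = 0 :=
  ext fun t ht => eq_zero_of_conv_one f.memC
    (fun s hs => by rw [← unit_mul_apply f hs, h, zero_apply]) ht

theorem eq_zero_of_mul_self {f : CRing} (h : f * f = 0) : f = 0 := by
  refine eq_zero_of_unit_mul (ext fun t ht => ?_)
  obtain ⟨F, hF, hFf⟩ := f.memC.exists_primitive
  have e : ∀ s, 0 < s → F s = (unit * f) s := fun s hs => by rw [hFf s hs, unit_mul_apply f hs]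
  rw [← e t ht, zero_apply]
  refine eq_zero_of_conv_self hF (fun s hs => ?_) ht
  rw [conv_congr e e hs, ← mul_apply _ _ hs]
  have : unit * f * (unit * f) = unit * unit * (f * f) := by simp only [mul_assoc, mul_left_comm]
  rw [this, h, mul_zero, zero_apply]

/-- Multiplication of a function by its argument. -/
def mulId (f : CRing) : CRing :=
  ⟨fun t => t * f t, by
    obtain ⟨p, hp, f₁, hc, h⟩ := f.memC
    refine ⟨p, hp, fun t => t * f₁ t, continuousOn_id.mul hc, fun t ht => ?_⟩
    simp only [h t ht]
    ring, fun t ht => by simp only [f.2.2 t ht, mul_zero]⟩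

theorem mulId_apply (f : CRing) (t : ℝ) : mulId f t = t * f t := rfl

theorem mulId_mul (f g : CRing) : mulId (f * g) = mulId f * g + f * mulId g :=
  ext fun t ht => by
    rw [mulId_apply, add_apply, mul_apply _ _ ht, mul_apply _ _ ht, mul_apply _ _ ht]
    refine Eq.trans ?_ (intervalIntegral.integral_add
      ((mulId f).memC.conv_intervalIntegrable g.memC ht)
      (f.memC.conv_intervalIntegrable (mulId g).memC ht))
    rw [conv, ← intervalIntegral.integral_const_mul]
    refine intervalIntegral.integral_congr fun s _ => ?_
    simp only [mulId_apply]
    ring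

theorem mul_mulId {f g : CRing} (h : f * g = 0) : f * mulId g = 0 := by
  have h0 : mulId (0 : CRing) = 0 := ext fun t _ => by rw [mulId_apply, zero_apply, mul_zero]
  have h1 : mulId f * g = -(f * mulId g) := by
    rw [eq_neg_iff_add_eq_zero, ← mulId_mul, h, h0]
  refine eq_zero_of_mul_self ?_
  have h2 : f * mulId g * (f * mulId g) = -((f * g) * (mulId f * mulId g)) := by
    calc f * mulId g * (f * mulId g) = -(-(f * mulId g) * (f * mulId g)) := by
          rw [neg_mul, neg_neg]
      _ = -((f * g) * (mulId f * mulId g)) := by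
          rw [← h1]; congr 1; simp only [mul_assoc, mul_left_comm, mul_comm]
  rw [h2, h, zero_mul, neg_zero]

theorem mul_mulId_iterate {f g : CRing} (h : f * g = 0) (n : ℕ) : f * mulId^[n] g = 0 := by
  induction n with
  | zero => exact h
  | succ n ih => rw [Function.iterate_succ_apply']; exact mul_mulId ih

theorem mulId_iterate_apply (f : CRing) (n : ℕ) (t : ℝ) : mulId^[n] f t = t ^ n * f t := by
  induction n with
  | zero => simp
  | succ n ih => rw [Function.iterate_succ_apply', mulId_apply, ih, pow_succ]; ring

/-- The convolution ring has no zero divisors. -/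
instance : NoZeroDivisors CRing where
  eq_zero_or_eq_zero_of_mul_eq_zero := by
    intro f g hfg
    have hFG : (unit * f) * (unit * g) = 0 := by
      have : unit * f * (unit * g) = unit * unit * (f * g) := by
        simp only [mul_assoc, mul_left_comm]
      rw [this, hfg, mul_zero]
    obtain ⟨F, hF, hFf⟩ := f.memC.exists_primitive
    obtain ⟨G, hG, hGg⟩ := g.memC.exists_primitive
    have eF : ∀ s, 0 < s → (unit * f) s = F s := fun s hs => by rw [hFf s hs, unit_mul_apply f hs]
    have eG : ∀ s, 0 < s → (unit * g) s = G s := fun s hs => by rw [hGg s hs, unit_mul_apply g hs]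
    have key : ∀ a b, 0 < a → 0 < b → F a * G b = 0 := by
      intro a b ha hb
      have := eq_zero_of_moments (φ := fun u => F (a + b - u) * G u) (T := a + b) (by fun_prop)
        (fun n => ?_) hb (by linarith)
      · simpa using this
      · have h1 := mul_apply (unit * f) (mulId^[n] (unit * g)) (add_pos ha hb)
        rw [mul_mulId_iterate hFG n, zero_apply, conv_congr (g' := fun s => s ^ n * G s) eF
          (fun s hs => by rw [mulId_iterate_apply, eG s hs]) (add_pos ha hb), conv] at h1
        refine Eq.trans ?_ h1.symm
        refine intervalIntegral.integral_congr fun s _ => ?_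
        ring
    by_cases h : ∀ a, 0 < a → F a = 0
    · exact Or.inl (eq_zero_of_unit_mul (ext fun t ht => by rw [eF t ht, h t ht, zero_apply]))
    · push Not at h
      obtain ⟨a, ha, hFa⟩ := h
      refine Or.inr (eq_zero_of_unit_mul (ext fun t ht => ?_))
      rw [eG t ht, zero_apply]
      exact (mul_eq_zero.1 (key a t ha ht)).resolve_left hFa

theorem unit_ne_zero : unit ≠ 0 := fun h => by
  have h1 : unit 1 = 1 := of_apply MemC.one one_pos
  rw [h, zero_apply] at h1
  exact zero_ne_one h1

theorem mul_cancel {f g h : CRing} (hh : h ≠ 0) (e : f * h = g * h) : f = g := by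
  have : (f - g) * h = 0 := by rw [sub_mul, e, sub_self]
  exact sub_eq_zero.1 ((mul_eq_zero.1 this).resolve_right hh)

end CRing

/-! ### The field `F_{-1}` of convolution quotients -/

/-- The set `C_{-1} × (C_{-1} \ {0})`. -/
abbrev CPair : Type := CRing × {g : CRing // g ≠ 0}

/-- `(f₁, g₁) ∼ (f₂, g₂)` if and only if `f₁ * g₂ = f₂ * g₁`. -/
instance cSetoid : Setoid CPair where
  r a b := a.1 * b.2.1 = b.1 * a.2.1
  iseqv :=
    { refl := fun _ => rfl
      symm := fun h => h.symm
      trans := by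
        intro a b c h1 h2
        refine CRing.mul_cancel b.2.2 ?_
        calc a.1 * c.2.1 * b.2.1 = (a.1 * b.2.1) * c.2.1 := by
              simp only [mul_assoc, mul_comm c.2.1]
          _ = (b.1 * c.2.1) * a.2.1 := by rw [h1]; simp only [mul_assoc, mul_comm a.2.1]
          _ = c.1 * a.2.1 * b.2.1 := by rw [h2]; simp only [mul_assoc, mul_comm b.2.1] }

/-- The set of convolution quotients. -/
def CField : Type := Quotient cSetoid

namespace CField

/-- The convolution quotient `f / g`. -/
def mk (f g : CRing) (hg : g ≠ 0) : CField := Quotient.mk cSetoid (f, ⟨g, hg⟩)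

theorem mk_eq_mk {f₁ g₁ f₂ g₂ : CRing} {h₁ : g₁ ≠ 0} {h₂ : g₂ ≠ 0} :
    mk f₁ g₁ h₁ = mk f₂ g₂ h₂ ↔ f₁ * g₂ = f₂ * g₁ := Quotient.eq (r := cSetoid)

theorem ind {P : CField → Prop} (h : ∀ f g hg, P (mk f g hg)) (x : CField) : P x :=
  Quotient.ind (s := cSetoid) (fun a => h a.1 a.2.1 a.2.2) x

instance : Zero CField := ⟨mk 0 CRing.unit CRing.unit_ne_zero⟩

instance : One CField := ⟨mk CRing.unit CRing.unit CRing.unit_ne_zero⟩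

instance : Neg CField :=
  ⟨Quotient.map (fun a : CPair => ((-a.1, a.2) : CPair)) (by
    intro a b (h : _ = _)
    change -a.1 * b.2.1 = -b.1 * a.2.1
    rw [neg_mul, neg_mul, h])⟩

instance : Add CField :=
  ⟨Quotient.map₂ (fun a b : CPair =>
      ((a.1 * b.2.1 + b.1 * a.2.1, ⟨a.2.1 * b.2.1, mul_ne_zero a.2.2 b.2.2⟩) : CPair)) (by
    intro a a' (h : _ = _) b b' (h' : _ = _)
    change (a.1 * b.2.1 + b.1 * a.2.1) * (a'.2.1 * b'.2.1)
      = (a'.1 * b'.2.1 + b'.1 * a'.2.1) * (a.2.1 * b.2.1)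
    calc _ = (a.1 * a'.2.1) * (b.2.1 * b'.2.1) + (b.1 * b'.2.1) * (a.2.1 * a'.2.1) := by
          rw [add_mul]; congr 1 <;> simp only [mul_assoc, mul_left_comm, mul_comm]
      _ = _ := by
          rw [h, h', add_mul]; congr 1 <;> simp only [mul_assoc, mul_left_comm, mul_comm])⟩

instance : Mul CField :=
  ⟨Quotient.map₂ (fun a b : CPair =>
      ((a.1 * b.1, ⟨a.2.1 * b.2.1, mul_ne_zero a.2.2 b.2.2⟩) : CPair)) (by
    intro a a' (h : _ = _) b b' (h' : _ = _)
    change (a.1 * b.1) * (a'.2.1 * b'.2.1) = (a'.1 * b'.1) * (a.2.1 * b.2.1)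
    calc _ = (a.1 * a'.2.1) * (b.1 * b'.2.1) := by
          simp only [mul_assoc, mul_left_comm]
      _ = _ := by rw [h, h']; simp only [mul_assoc, mul_left_comm])⟩

/-- Scalar multiplication `λ (f / g) = (λ f) / g`. -/
instance : SMul ℝ CField :=
  ⟨fun c => Quotient.map (fun a : CPair => ((c • a.1, a.2) : CPair)) (by
    intro a b (h : _ = _)
    change (c • a.1) * b.2.1 = (c • b.1) * a.2.1
    rw [CRing.smul_mul, CRing.smul_mul, h])⟩

theorem mk_add_mk {f₁ g₁ f₂ g₂ : CRing} (h₁ : g₁ ≠ 0) (h₂ : g₂ ≠ 0) :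
    mk f₁ g₁ h₁ + mk f₂ g₂ h₂ = mk (f₁ * g₂ + f₂ * g₁) (g₁ * g₂) (mul_ne_zero h₁ h₂) := rfl

theorem mk_mul_mk {f₁ g₁ f₂ g₂ : CRing} (h₁ : g₁ ≠ 0) (h₂ : g₂ ≠ 0) :
    mk f₁ g₁ h₁ * mk f₂ g₂ h₂ = mk (f₁ * f₂) (g₁ * g₂) (mul_ne_zero h₁ h₂) := rfl

theorem neg_mk {f g : CRing} (h : g ≠ 0) : -mk f g h = mk (-f) g h := rfl

theorem smul_mk (c : ℝ) {f g : CRing} (h : g ≠ 0) : c • mk f g h = mk (c • f) g h := rfl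

theorem zero_def : (0 : CField) = mk 0 CRing.unit CRing.unit_ne_zero := rfl

theorem one_def : (1 : CField) = mk CRing.unit CRing.unit CRing.unit_ne_zero := rfl

theorem mk_eq_zero {f g : CRing} (h : g ≠ 0) : mk f g h = 0 ↔ f = 0 := by
  rw [zero_def, mk_eq_mk, zero_mul, mul_eq_zero]
  exact or_iff_left CRing.unit_ne_zero

open Classical in
instance : Inv CField :=
  ⟨Quotient.map (fun a : CPair =>
      if h : a.1 = 0 then ((0, a.2) : CPair) else ((a.2.1, ⟨a.1, h⟩) : CPair)) (by
    intro a b (h : _ = _)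
    by_cases ha : a.1 = 0
    · have hb : b.1 = 0 := by
        rw [ha, zero_mul] at h
        exact (mul_eq_zero.1 h.symm).resolve_right a.2.2
      simp only [ha, hb, dif_pos]
      change 0 * b.2.1 = 0 * a.2.1
      rw [zero_mul, zero_mul]
    · have hb : b.1 ≠ 0 := by
        intro hb
        rw [hb, zero_mul] at h
        exact ha ((mul_eq_zero.1 h).resolve_right b.2.2)
      simp only [ha, hb, dif_neg, not_false_eq_true]
      change a.2.1 * b.1 = b.2.1 * a.1
      rw [mul_comm, ← h, mul_comm])⟩

theorem inv_mk {f g : CRing} (hf : f ≠ 0) (hg : g ≠ 0) : (mk f g hg)⁻¹ = mk g f hf := by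
  change Quotient.mk cSetoid _ = _
  simp only [dif_neg hf]
  rfl

theorem inv_zero' : (0 : CField)⁻¹ = 0 := by
  change Quotient.mk cSetoid _ = _
  simp only [dif_pos]
  rfl

instance : CommRing CField where
  add_assoc := ind fun f₁ g₁ h₁ => ind fun f₂ g₂ h₂ => ind fun f₃ g₃ h₃ => by
    rw [mk_add_mk, mk_add_mk, mk_add_mk, mk_add_mk, mk_eq_mk]
    simp only [mul_assoc, mul_left_comm, mul_comm, add_mul, mul_add, add_assoc]
  zero_add := ind fun f g h => by
    rw [zero_def, mk_add_mk, mk_eq_mk, zero_mul, zero_add, mul_assoc]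
  add_zero := ind fun f g h => by
    rw [zero_def, mk_add_mk, mk_eq_mk, zero_mul, add_zero, mul_assoc, mul_comm g]
  add_comm := ind fun f₁ g₁ h₁ => ind fun f₂ g₂ h₂ => by
    rw [mk_add_mk, mk_add_mk, mk_eq_mk, add_comm, mul_comm g₁]
  neg_add_cancel := ind fun f g h => by
    rw [neg_mk, mk_add_mk, mk_eq_zero, neg_mul, neg_add_cancel]
  mul_assoc := ind fun f₁ g₁ h₁ => ind fun f₂ g₂ h₂ => ind fun f₃ g₃ h₃ => by
    simp only [mk_mul_mk, mul_assoc]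
  mul_comm := ind fun f₁ g₁ h₁ => ind fun f₂ g₂ h₂ => by
    rw [mk_mul_mk, mk_mul_mk, mk_eq_mk, mul_comm f₁, mul_comm g₁]
  one_mul := ind fun f g h => by
    rw [one_def, mk_mul_mk, mk_eq_mk]
    simp only [mul_assoc, mul_left_comm]
  mul_one := ind fun f g h => by
    rw [one_def, mk_mul_mk, mk_eq_mk]
    simp only [mul_assoc, mul_comm CRing.unit]
  zero_mul := ind fun f g h => by rw [zero_def, mk_mul_mk, zero_mul]; exact (mk_eq_zero _).2 rfl
  mul_zero := ind fun f g h => by rw [zero_def, mk_mul_mk, mul_zero]; exact (mk_eq_zero _).2 rfl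
  left_distrib := ind fun f₁ g₁ h₁ => ind fun f₂ g₂ h₂ => ind fun f₃ g₃ h₃ => by
    simp only [mk_mul_mk, mk_add_mk, mk_eq_mk]
    simp only [mul_assoc, mul_left_comm, mul_comm, add_mul, mul_add]
  right_distrib := ind fun f₁ g₁ h₁ => ind fun f₂ g₂ h₂ => ind fun f₃ g₃ h₃ => by
    simp only [mk_mul_mk, mk_add_mk, mk_eq_mk]
    simp only [mul_assoc, mul_left_comm, mul_comm, add_mul, mul_add]
  nsmul := nsmulRec
  zsmul := zsmulRec

/-- The convolution quotients form a field. -/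
instance : Field CField where
  exists_pair_ne := ⟨0, 1, fun h => CRing.unit_ne_zero ((mk_eq_zero _).1 h.symm)⟩
  mul_inv_cancel := ind fun f g h hne => by
    have hf : f ≠ 0 := fun hf => hne ((mk_eq_zero h).2 hf)
    rw [inv_mk hf, mk_mul_mk, one_def, mk_eq_mk]
    simp only [mul_comm]
  inv_zero := inv_zero'
  nnqsmul := _
  nnqsmul_def := fun _ _ => rfl
  qsmul := _
  qsmul_def := fun _ _ => rfl

/-- The embedding `f ↦ (f * κ) / κ` of `R_{-1}` into `F_{-1}`. -/
def emb (κ : CRing) (hκ : κ ≠ 0) (f : CRing) : CField := mk (f * κ) κ hκ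

end CField

/-! ### General fractional integrals and derivatives -/

/-- The general fractional integral `𝕀_(κ) f = κ * f`. -/
def gfi (κ f : ℝ → ℝ) : ℝ → ℝ := conv κ f

/-- The general fractional derivative `𝔻_(k) f = d/dt 𝕀_(k) f` of Riemann-Liouville type. -/
def rlGFD (k f : ℝ → ℝ) : ℝ → ℝ := deriv (gfi k f)

/-- The 1st level general fractional derivative `𝕀_(k₁) d/dt 𝕀_(k₂) f`. -/
def firstGFD (k₁ k₂ f : ℝ → ℝ) : ℝ → ℝ := gfi k₁ (rlGFD k₂ f)

/-- The 1st level general fractional derivative of `f` exists classically on `(0,+∞)`: both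
integrals converge and the inner one is differentiable at every `t > 0`. -/
structure FirstGFDExists (k₁ k₂ f : ℝ → ℝ) : Prop where
  inner_integrable : ∀ t, 0 < t → IntervalIntegrable (fun τ => k₂ (t - τ) * f τ) volume 0 t
  differentiable : ∀ t, 0 < t → DifferentiableAt ℝ (gfi k₂ f) t
  outer_integrable : ∀ t, 0 < t →
    IntervalIntegrable (fun τ => k₁ (t - τ) * rlGFD k₂ f τ) volume 0 t

/-- The `n`-fold sequential 1st level general fractional derivative. -/
def seqGFD (k₁ k₂ : ℝ → ℝ) : ℕ → (ℝ → ℝ) → ℝ → ℝ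
  | 0, f => f
  | n + 1, f => firstGFD k₁ k₂ (seqGFD k₁ k₂ n f)

/-- The `n`-fold sequential derivative exists classically: each of the `n` successive
derivatives does. -/
def SeqGFDExists (k₁ k₂ : ℝ → ℝ) (n : ℕ) (f : ℝ → ℝ) : Prop :=
  ∀ j < n, FirstGFDExists k₁ k₂ (seqGFD k₁ k₂ j f)

/-- The space `C^m_{-1,(k₁,k₂)}(0,+∞)`. -/
def MemCm (k₁ k₂ : ℝ → ℝ) (m : ℕ) (f : ℝ → ℝ) : Prop :=
  ∀ j ≤ m, MemC (seqGFD k₁ k₂ j f) ∧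
    (∀ t, 0 < t → DifferentiableAt ℝ (gfi k₂ (seqGFD k₁ k₂ j f)) t) ∧
    MemC (rlGFD k₂ (seqGFD k₁ k₂ j f))

/-- The triples of 1st level kernels: functions of the class `C_{-1}(0,+∞)` with
`κ * k₁ * k₂ = 1` on `(0,+∞)`. -/
structure IsKernelTriple (κ k₁ k₂ : ℝ → ℝ) : Prop where
  mem_κ : MemC κ
  mem_k₁ : MemC k₁
  mem_k₂ : MemC k₂
  conv_eq_one : ∀ t, 0 < t → conv (conv κ k₁) k₂ t = 1

/-- The value at `0` of a function on `(0,+∞)` that extends continuously to `[0,+∞)`. -/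
def valueAtZero (g : ℝ → ℝ) : ℝ := limUnder (𝓝[>] 0) g

/-- The shifted convolution powers: `convPowSucc κ j` is `κ^{<j+1>}`. -/
def convPowSucc (κ : ℝ → ℝ) : ℕ → ℝ → ℝ
  | 0 => κ
  | j + 1 => conv (convPowSucc κ j) κ

/-- The projector
`P^{<n>} f = ∑_{j<n} (𝕀_(k₂) 𝔻^{<j>} f)(0) κ^{<j+1>} * k₁`. -/
def projector (κ k₁ k₂ : ℝ → ℝ) (n : ℕ) (f : ℝ → ℝ) : ℝ → ℝ := fun t =>
  ∑ j ∈ Finset.range n, valueAtZero (gfi k₂ (seqGFD k₁ k₂ j f)) * conv (convPowSucc κ j) k₁ t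

theorem memC_convPowSucc {κ : ℝ → ℝ} (hκ : MemC κ) (j : ℕ) : MemC (convPowSucc κ j) := by
  induction j with
  | zero => exact hκ
  | succ j ih => exact ih.conv hκ

namespace IsKernelTriple

/-- The kernel `κ` as an element of `R_{-1}`. -/
def kernel {κ k₁ k₂ : ℝ → ℝ} (hK : IsKernelTriple κ k₁ k₂) : CRing := CRing.of κ hK.mem_κ

theorem kernel_ne_zero {κ k₁ k₂ : ℝ → ℝ} (hK : IsKernelTriple κ k₁ k₂) : hK.kernel ≠ 0 := by
  intro h
  have h0 : ∀ t, 0 < t → κ t = 0 := fun t ht => by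
    rw [← CRing.of_apply hK.mem_κ ht]
    exact congrArg (fun f : CRing => f t) h
  have h1 : ∀ t, 0 < t → conv κ k₁ t = 0 := fun t ht => by
    rw [conv_congr h0 (g' := k₁) (fun _ _ => rfl) ht]
    simp [conv]
  have h2 := hK.conv_eq_one 1 one_pos
  rw [conv_congr h1 (g' := k₂) (fun _ _ => rfl) one_pos] at h2
  simp [conv] at h2

/-- A function of the class `C_{-1}(0,+∞)` interpreted as an element of `F_{-1}`. -/
def toField {κ k₁ k₂ : ℝ → ℝ} (hK : IsKernelTriple κ k₁ k₂)
    (f : ℝ → ℝ) (hf : MemC f) : CField :=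
  CField.emb hK.kernel hK.kernel_ne_zero (CRing.of f hf)

/-- The algebraic inverse `S_κ = κ / κ^{<2>}` to the general fractional integral. -/
def S {κ k₁ k₂ : ℝ → ℝ} (hK : IsKernelTriple κ k₁ k₂) : CField :=
  CField.mk hK.kernel (hK.kernel * hK.kernel) (mul_ne_zero hK.kernel_ne_zero hK.kernel_ne_zero)

theorem memC_projector {κ k₁ k₂ : ℝ → ℝ} (hK : IsKernelTriple κ k₁ k₂)
    (n : ℕ) (f : ℝ → ℝ) : MemC (projector κ k₁ k₂ n f) :=
  MemC.sum _ fun j => ((memC_convPowSucc hK.mem_κ j).conv hK.mem_k₁).smul _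

/-- The `n`-fold sequential 1st level algebraic general fractional derivative
`S_κ^n · f - S_κ^n · P^{<n>} f`. -/
def algGFD {κ k₁ k₂ : ℝ → ℝ} (hK : IsKernelTriple κ k₁ k₂)
    (n : ℕ) (f : ℝ → ℝ) (hf : MemC f) : CField :=
  hK.S ^ n * hK.toField f hf
    - hK.S ^ n * hK.toField (projector κ k₁ k₂ n f) (hK.memC_projector n f)

end IsKernelTriple

theorem MemCm.memC {k₁ k₂ : ℝ → ℝ} {m : ℕ} {f : ℝ → ℝ} (hf : MemCm k₁ k₂ m f) : MemC f :=
  (hf 0 (Nat.zero_le m)).1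

end GFC

end

/-! One application of the 1st level derivative can be inverted inside the convolution ring. Suppose
`k₂ * g` is differentiable on (0,∞) with derivative w in C_{-1}. Then w is integrable up to 0, so
`k₂ * g` has a finite limit c at 0, and `k₂ * g = c·1 + 1 * w`. Both constants 1 may be replaced by
`κ * k₁ * k₂`, and `k₂` then cancels because the ring has no zero divisors. What remains is `g = c
(κ * k₁) + κ * (k₁ * w)`, where `k₁ * w` is exactly the 1st level derivative of g
(`of_eq_smul_add`).

In the field of quotients S_κ is the inverse of κ, so multiplication by S_κ turns this into
"derivative of g = S_κ·g − c·k₁" (`toField_firstGFD`). Iteration gives S_κ^n·f minus the sum of the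
c_j S_κ^{n-j-1}·k₁ (`toField_seqGFD`). The algebraic derivative has the same expansion, since S_κ^n
cancels the j+1 factors κ in the j-th term of the projector (`S_pow_mul_toField_projector`).

The analytic claims follow from the same data. The limits at 0 come from
`tendsto_valueAtZero_and_eq_add_integral`. The n-th derivative lies in C_{-1} because it is the
convolution of `k₁` with the derivative w belonging to level n−1. -/

namespace GFC

/-! ### Boundary behaviour at 0 of functions with derivative in C_{-1} -/

/-- A function with derivative of class `C_{-1}` on `(0,+∞)` has a finite limit at `0` and is
recovered from it by integration. -/
theorem tendsto_valueAtZero_and_eq_add_integral {u : ℝ → ℝ}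
    (hd : ∀ t, 0 < t → DifferentiableAt ℝ u t) (hw : MemC (deriv u)) :
    Tendsto u (𝓝[>] 0) (𝓝 (valueAtZero u)) ∧
      ∀ t, 0 < t → u t = valueAtZero u + conv (fun _ => 1) (deriv u) t := by
  obtain ⟨F, hF, hFw⟩ := hw.exists_primitive
  have hsub : ∀ t, 0 < t → u t = u 1 - F 1 + F t := by
    intro t ht
    have hpos : ∀ x ∈ uIcc 1 t, 0 < x := fun x hx => (lt_min one_pos ht).trans_le hx.1
    -- Starting from the base point 1 keeps the interval inside (0,∞), whichever of 1 and t is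
    -- larger. There `deriv u` is continuous, so its possible singularity at 0 plays no role.
    have h1 : ∫ x in (1 : ℝ)..t, deriv u x = u t - u 1 := by
      refine intervalIntegral.integral_deriv_eq_sub (fun x hx => hd x (hpos x hx)) ?_
      exact (hw.continuousOn.mono hpos).intervalIntegrable
    have h2 := intervalIntegral.integral_interval_sub_left
      (hw.intervalIntegrable ht.le) (hw.intervalIntegrable zero_le_one)
    rw [hFw t ht, hFw 1 one_pos]
    simp only [conv, one_mul]
    linarith
  -- `exists_primitive` describes F by the integral only for t > 0. Its value at 0 is recovered from
  -- uniqueness of limits: F is continuous, and the integral over [0,t] tends to 0 with t.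
  have hF0 : F 0 = 0 := by
    have h1 : Tendsto F (𝓝[>] 0) (𝓝 (F 0)) := (hF.tendsto 0).mono_left nhdsWithin_le_nhds
    have h2 : Tendsto F (𝓝[>] 0) (𝓝 0) := by
      have hc := intervalIntegral.continuousOn_primitive_interval
        (f := deriv u) (μ := volume) (a := 0) (b := 1)
        ((intervalIntegrable_iff' (by simp)).1 (hw.intervalIntegrable zero_le_one))
      have h3 := (hc 0 (by simp)).mono_left (nhdsWithin_mono _ (by
        rw [uIcc_of_le zero_le_one]; exact Ioc_subset_Icc_self) : 𝓝[Ioc (0 : ℝ) 1] 0 ≤ _)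
      simp only [nhdsWithin_Ioc_eq_nhdsGT one_pos, intervalIntegral.integral_same] at h3
      refine h3.congr' ?_
      filter_upwards [self_mem_nhdsWithin] with t ht
      rw [hFw t ht]
      simp only [conv, one_mul]
    exact tendsto_nhds_unique h1 h2
  have hlim : Tendsto u (𝓝[>] 0) (𝓝 (u 1 - F 1)) := by
    have h1 : Tendsto (fun t => u 1 - F 1 + F t) (𝓝[>] 0) (𝓝 (u 1 - F 1 + F 0)) :=
      ((hF.tendsto 0).mono_left nhdsWithin_le_nhds).const_add _
    rw [hF0, add_zero] at h1
    refine h1.congr' ?_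
    filter_upwards [self_mem_nhdsWithin] with t ht using (hsub t ht).symm
  -- `valueAtZero` is a `limUnder`, hence meaningful only once convergence is known; `hlim` supplies
  -- it.
  have hv : valueAtZero u = u 1 - F 1 := hlim.limUnder_eq
  rw [hv]
  exact ⟨hlim, fun t ht => by rw [← hFw t ht]; exact hsub t ht⟩

/-! ### Compatibility of the embedding with sums, products and scalars -/

theorem CRing.of_mul_of {f g : ℝ → ℝ} (hf : MemC f) (hg : MemC g) :
    CRing.of f hf * CRing.of g hg = CRing.of (conv f g) (hf.conv hg) :=
  CRing.ext fun t ht => by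
    rw [CRing.mul_apply _ _ ht, CRing.of_apply _ ht]
    exact conv_congr (fun _ hs => CRing.of_apply hf hs) (fun _ hs => CRing.of_apply hg hs) ht

namespace CField

/-- Real scalars act on `CField` through a bare `SMul`. Trading the action for multiplication by the
field element `c • 1` makes it accessible to `ring` and `linear_combination`. -/
theorem smul_eq_mul (c : ℝ) (x : CField) : c • x = (c • (1 : CField)) * x := by
  induction x using ind with | h f g h
  rw [one_def, smul_mk, smul_mk, mk_mul_mk, mk_eq_mk]
  simp only [CRing.smul_mul]
  congr 1
  simp only [mul_assoc, mul_left_comm]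

theorem emb_add (κ : CRing) (hκ : κ ≠ 0) (f g : CRing) :
    emb κ hκ (f + g) = emb κ hκ f + emb κ hκ g := by
  rw [emb, emb, emb, mk_add_mk, mk_eq_mk]
  simp only [add_mul, mul_assoc]

theorem emb_mul (κ : CRing) (hκ : κ ≠ 0) (f g : CRing) :
    emb κ hκ (f * g) = emb κ hκ f * emb κ hκ g := by
  rw [emb, emb, emb, mk_mul_mk, mk_eq_mk]
  simp only [mul_assoc, mul_left_comm, mul_comm]

theorem emb_smul (κ : CRing) (hκ : κ ≠ 0) (c : ℝ) (f : CRing) :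
    emb κ hκ (c • f) = c • emb κ hκ f := by
  rw [emb, emb, smul_mk, CRing.smul_mul]

theorem emb_zero (κ : CRing) (hκ : κ ≠ 0) : emb κ hκ 0 = 0 := by
  rw [emb, mk_eq_zero, zero_mul]

end CField

/-! ### Functions as field elements, and the arithmetic of S_κ -/

namespace IsKernelTriple

variable {κ k₁ k₂ : ℝ → ℝ} (hK : IsKernelTriple κ k₁ k₂)

/-- `CRing.of` sees a function only on (0,∞), so values at t ≤ 0 are irrelevant. -/
theorem toField_congr {f g : ℝ → ℝ} (hf : MemC f) (hg : MemC g) (h : ∀ t, 0 < t → f t = g t) :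
    hK.toField f hf = hK.toField g hg :=
  congrArg _ (CRing.ext fun t ht => by rw [CRing.of_apply _ ht, CRing.of_apply _ ht, h t ht])

theorem toField_conv {f g : ℝ → ℝ} (hf : MemC f) (hg : MemC g) :
    hK.toField (conv f g) (hf.conv hg) = hK.toField f hf * hK.toField g hg := by
  rw [toField, ← CRing.of_mul_of, CField.emb_mul]; rfl

theorem toField_add {f g : ℝ → ℝ} (hf : MemC f) (hg : MemC g) :
    hK.toField (fun t => f t + g t) (hf.add hg) = hK.toField f hf + hK.toField g hg := by
  rw [toField, toField, toField, ← CField.emb_add]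
  exact congrArg _ (CRing.ext fun t ht => by
    rw [CRing.add_apply, CRing.of_apply _ ht, CRing.of_apply _ ht, CRing.of_apply _ ht])

theorem toField_smul {f : ℝ → ℝ} (hf : MemC f) (c : ℝ) :
    hK.toField (fun t => c * f t) (hf.smul c) = c • hK.toField f hf := by
  rw [toField, toField, ← CField.emb_smul]
  exact congrArg _ (CRing.ext fun t ht => by
    rw [CRing.smul_apply, CRing.of_apply _ ht, CRing.of_apply _ ht])

theorem toField_sum {f : ℕ → ℝ → ℝ} (hf : ∀ j, MemC (f j)) (n : ℕ) :
    hK.toField (fun t => ∑ j ∈ Finset.range n, f j t) (MemC.sum _ hf) =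
      ∑ j ∈ Finset.range n, hK.toField (f j) (hf j) := by
  induction n with
  | zero =>
    rw [Finset.sum_range_zero, ← CField.emb_zero hK.kernel hK.kernel_ne_zero]
    exact congrArg _ (CRing.ext fun t ht => by
      rw [CRing.of_apply _ ht, CRing.zero_apply, Finset.sum_range_zero])
  | succ n ih =>
    rw [Finset.sum_range_succ, ← ih, ← toField_add]
    exact hK.toField_congr _ _ fun t _ => Finset.sum_range_succ _ _

/-- S_κ is κ/(κ*κ) and the embedded kernel is (κ*κ)/κ, so numerator and denominator of the product
coincide. This relation is the only property of S_κ used below. -/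
theorem S_mul_toField_kernel : hK.S * hK.toField κ hK.mem_κ = 1 := by
  change CField.mk _ _ _ * CField.mk (hK.kernel * hK.kernel) _ hK.kernel_ne_zero = _
  rw [CField.mk_mul_mk, CField.one_def, CField.mk_eq_mk]
  simp only [mul_assoc, mul_left_comm, mul_comm]

/-- `convPowSucc κ j` contains j+1 factors κ, and each absorbs one S_κ. Writing the exponent as a
sum avoids truncated subtraction. -/
theorem S_pow_mul_toField_convPowSucc (m j : ℕ) :
    hK.S ^ (m + (j + 1)) * hK.toField (convPowSucc κ j) (memC_convPowSucc hK.mem_κ j)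
      = hK.S ^ m := by
  induction j with
  | zero =>
    rw [zero_add, pow_succ, mul_assoc]
    exact (congrArg _ hK.S_mul_toField_kernel).trans (mul_one _)
  | succ j ih =>
    rw [← ih]
    refine (congrArg _ (hK.toField_conv (memC_convPowSucc hK.mem_κ j) hK.mem_κ)).trans ?_
    -- The additional factor κ cancels the additional S_κ; the multiplier is the part common to both
    -- sides.
    linear_combination hK.S ^ (m + (j + 1)) *
      hK.toField (convPowSucc κ j) (memC_convPowSucc hK.mem_κ j) * hK.S_mul_toField_kernel

/-- The powers of κ in the projector cancel term by term against S_κ^n, leaving only `k₁` and the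
surplus power of S_κ. -/
theorem S_pow_mul_toField_projector (n : ℕ) (f : ℝ → ℝ) :
    hK.S ^ n * hK.toField (projector κ k₁ k₂ n f) (hK.memC_projector n f) =
      ∑ j ∈ Finset.range n, valueAtZero (gfi k₂ (seqGFD k₁ k₂ j f)) •
        (hK.S ^ (n - j - 1) * hK.toField k₁ hK.mem_k₁) := by
  have h := hK.toField_sum
    (fun j => ((memC_convPowSucc hK.mem_κ j).conv hK.mem_k₁).smul
      (valueAtZero (gfi k₂ (seqGFD k₁ k₂ j f)))) n
  refine (congrArg _ h).trans ?_
  rw [Finset.mul_sum]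
  refine Finset.sum_congr rfl fun j hj => ?_
  -- Since j < n, the natural-number subtraction `n - j - 1` is genuine and equals m.
  obtain ⟨m, rfl⟩ : ∃ m, n = m + (j + 1) :=
    ⟨n - (j + 1), by have := Finset.mem_range.1 hj; omega⟩
  have e : m + (j + 1) - j - 1 = m := by omega
  have hj₁ := memC_convPowSucc hK.mem_κ j
  -- The second `smul_eq_mul` needs its explicit argument: otherwise it could match the `c • 1`
  -- created by the first.
  rw [e, hK.toField_smul (hj₁.conv hK.mem_k₁), hK.toField_conv hj₁ hK.mem_k₁,
    CField.smul_eq_mul, CField.smul_eq_mul _ (hK.S ^ m * _),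
    ← hK.S_pow_mul_toField_convPowSucc m j]
  ring

/-! ### One step of the derivative in the ring and in the field, and its iteration -/

theorem of_conv_conv :
    CRing.of κ hK.mem_κ * CRing.of k₁ hK.mem_k₁ * CRing.of k₂ hK.mem_k₂ = CRing.unit := by
  rw [CRing.of_mul_of, CRing.of_mul_of]
  exact CRing.ext fun t ht => by
    rw [CRing.of_apply _ ht, CRing.unit, CRing.of_apply _ ht, hK.conv_eq_one t ht]

/-- The second fundamental theorem for the 1st level derivative, in the convolution ring. -/
theorem of_eq_smul_add {g : ℝ → ℝ} (hg : MemC g)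
    (hd : ∀ t, 0 < t → DifferentiableAt ℝ (gfi k₂ g) t) (hw : MemC (rlGFD k₂ g)) :
    CRing.of g hg = valueAtZero (gfi k₂ g) • (CRing.of κ hK.mem_κ * CRing.of k₁ hK.mem_k₁)
      + CRing.of κ hK.mem_κ * CRing.of (firstGFD k₁ k₂ g) (hK.mem_k₁.conv hw) := by
  have hunit := hK.of_conv_conv
  -- If `k₂` vanished, so would the product `κ * k₁ * k₂`, which is the constant 1.
  have hk₂ : CRing.of k₂ hK.mem_k₂ ≠ 0 := fun h =>
    CRing.unit_ne_zero (by rw [← hunit, h, mul_zero])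
  -- The fundamental theorem of calculus for `k₂ * g`, read in the ring: integration is convolution
  -- with `unit`.
  have hprim : CRing.of g hg * CRing.of k₂ hK.mem_k₂ =
      valueAtZero (gfi k₂ g) • CRing.unit + CRing.unit * CRing.of (rlGFD k₂ g) hw := by
    rw [mul_comm, CRing.of_mul_of]
    refine CRing.ext fun t ht => ?_
    rw [CRing.of_apply _ ht, CRing.add_apply, CRing.smul_apply, CRing.unit_mul_apply _ ht,
      CRing.unit, CRing.of_apply _ ht, mul_one,
      conv_congr (f' := fun _ => 1) (fun _ _ => rfl) (fun _ hs => CRing.of_apply hw hs) ht]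
    exact (tendsto_valueAtZero_and_eq_add_integral hd hw).2 t ht
  have hfirst : CRing.of (firstGFD k₁ k₂ g) (hK.mem_k₁.conv hw) =
      CRing.of k₁ hK.mem_k₁ * CRing.of (rlGFD k₂ g) hw :=
    (CRing.of_mul_of hK.mem_k₁ hw).symm
  -- Absence of zero divisors enters here: after `unit` is expanded as `κ * k₁ * k₂`, both sides
  -- carry the factor `k₂`.
  refine CRing.mul_cancel hk₂ ?_
  rw [hprim, hfirst, add_mul, CRing.smul_mul, ← hunit]
  simp only [mul_assoc, mul_left_comm, mul_comm]

/-- Multiplying the ring identity `of_eq_smul_add` by S_κ removes κ from both terms on its right.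
The boundary value survives as a multiple of `k₁`. -/
theorem toField_firstGFD {g : ℝ → ℝ} (hg : MemC g)
    (hd : ∀ t, 0 < t → DifferentiableAt ℝ (gfi k₂ g) t) (hw : MemC (rlGFD k₂ g)) :
    hK.toField (firstGFD k₁ k₂ g) (hK.mem_k₁.conv hw) = hK.S * hK.toField g hg
      - valueAtZero (gfi k₂ g) • hK.toField k₁ hK.mem_k₁ := by
  have h : hK.toField g hg = valueAtZero (gfi k₂ g) •
      (hK.toField κ hK.mem_κ * hK.toField k₁ hK.mem_k₁) +
      hK.toField κ hK.mem_κ * hK.toField (firstGFD k₁ k₂ g) (hK.mem_k₁.conv hw) := by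
    rw [toField, hK.of_eq_smul_add hg hd hw, CField.emb_add, CField.emb_smul, CField.emb_mul,
      CField.emb_mul]
    rfl
  rw [CField.smul_eq_mul] at h ⊢
  -- The first summand multiplies the identity by S_κ; the second replaces S_κ·κ by 1 in the two
  -- terms where it then appears.
  linear_combination (-hK.S) * h - (hK.toField (firstGFD k₁ k₂ g) (hK.mem_k₁.conv hw) +
    valueAtZero (gfi k₂ g) • (1 : CField) * hK.toField k₁ hK.mem_k₁) * hK.S_mul_toField_kernel

/-- Each further derivative multiplies what is already there by S_κ and subtracts one new boundary
term. Conditions indexed by j < n, instead of `MemCm` at n − 1, let the induction start at n = 0. -/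
theorem toField_seqGFD {n : ℕ} {f : ℝ → ℝ}
    (hf : ∀ j < n, MemC (seqGFD k₁ k₂ j f) ∧
      (∀ t, 0 < t → DifferentiableAt ℝ (gfi k₂ (seqGFD k₁ k₂ j f)) t) ∧
      MemC (rlGFD k₂ (seqGFD k₁ k₂ j f)))
    (hD : ∀ j ≤ n, MemC (seqGFD k₁ k₂ j f)) :
    hK.toField (seqGFD k₁ k₂ n f) (hD n le_rfl) =
      hK.S ^ n * hK.toField f (hD 0 (Nat.zero_le n)) -
      ∑ j ∈ Finset.range n, valueAtZero (gfi k₂ (seqGFD k₁ k₂ j f)) •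
        (hK.S ^ (n - j - 1) * hK.toField k₁ hK.mem_k₁) := by
  induction n with
  | zero => rw [pow_zero, one_mul, Finset.sum_range_zero, sub_zero]; rfl
  | succ n ih =>
    obtain ⟨hg, hd, hw⟩ := hf n n.lt_succ_self
    refine (hK.toField_firstGFD hg hd hw).trans ?_
    rw [ih (fun j hj => hf j (by omega)) (fun j hj => hD j (by omega)), Finset.sum_range_succ,
      mul_sub, Finset.mul_sum, pow_succ', mul_assoc, ← sub_sub]
    congr 2
    · refine Finset.sum_congr rfl fun j hj => ?_
      -- For the old terms j < n, so the subtraction does not truncate and S_κ raises the exponent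
      -- by one.
      have e : n + 1 - j - 1 = (n - j - 1) + 1 := by have := Finset.mem_range.1 hj; omega
      rw [e, pow_succ', CField.smul_eq_mul, CField.smul_eq_mul _ (hK.S * _ * _)]
      ring
    -- The new term j = n carries S_κ to the power 0.
    · rw [Nat.add_sub_cancel_left, Nat.sub_self, pow_zero, one_mul]

end IsKernelTriple

end GFC

/-! ### Assembly: classical existence, boundary limits, and the identity in the field -/

theorem theorem4p2 {κ k₁ k₂ : ℝ → ℝ} (hK : GFC.IsKernelTriple κ k₁ k₂) (n : ℕ) (hn : 1 ≤ n)
    (f : ℝ → ℝ) (hf : GFC.MemCm k₁ k₂ (n - 1) f) :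
    GFC.SeqGFDExists k₁ k₂ n f ∧
    (∀ j < n, Tendsto (GFC.gfi k₂ (GFC.seqGFD k₁ k₂ j f)) (𝓝[>] 0)
      (𝓝 (GFC.valueAtZero (GFC.gfi k₂ (GFC.seqGFD k₁ k₂ j f))))) ∧
    ∃ hD : GFC.MemC (GFC.seqGFD k₁ k₂ n f),
      hK.toField (GFC.seqGFD k₁ k₂ n f) hD = hK.algGFD n f hf.memC ∧
      hK.algGFD n f hf.memC = hK.S ^ n * hK.toField f hf.memC
        - ∑ j ∈ Finset.range n, GFC.valueAtZero (GFC.gfi k₂ (GFC.seqGFD k₁ k₂ j f)) •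
            (hK.S ^ (n - j - 1) * hK.toField k₁ hK.mem_k₁) := by
  
  have hCm : ∀ j < n, GFC.MemC (GFC.seqGFD k₁ k₂ j f) ∧
      (∀ t, 0 < t → DifferentiableAt ℝ (GFC.gfi k₂ (GFC.seqGFD k₁ k₂ j f)) t) ∧
      GFC.MemC (GFC.rlGFD k₂ (GFC.seqGFD k₁ k₂ j f)) := fun j hj => hf j (by omega)
  refine ⟨fun j hj => ?_, fun j hj => ?_, ?_⟩
  · obtain ⟨hg, hd, hw⟩ := hCm j hj
    -- Both integrals converge because two factors in C_{-1} always have an integrable convolution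
    -- integrand.
    exact ⟨fun t ht => hK.mem_k₂.conv_intervalIntegrable hg ht, hd,
      fun t ht => hK.mem_k₁.conv_intervalIntegrable hw ht⟩
  · obtain ⟨hg, hd, hw⟩ := hCm j hj
    exact (GFC.tendsto_valueAtZero_and_eq_add_integral hd hw).1
  -- The hypothesis on f stops at level n − 1. Level n is reached because level j+1 is `k₁`
  -- convolved with a C_{-1} function furnished by level j.
  · have hD : ∀ j ≤ n, GFC.MemC (GFC.seqGFD k₁ k₂ j f) := by
      rintro (_ | j) hj
      · exact hf.memC
      · exact hK.mem_k₁.conv (hCm j hj).2.2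
    have h1 : hK.algGFD n f hf.memC = hK.S ^ n * hK.toField f hf.memC
        - ∑ j ∈ Finset.range n, GFC.valueAtZero (GFC.gfi k₂ (GFC.seqGFD k₁ k₂ j f)) •
            (hK.S ^ (n - j - 1) * hK.toField k₁ hK.mem_k₁) := by
      rw [GFC.IsKernelTriple.algGFD, hK.S_pow_mul_toField_projector]
    refine ⟨hD n le_rfl, ?_, h1⟩
    rw [h1]
    exact hK.toField_seqGFD hCm hD
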